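/- **Setting.** Let $P=(A_P,B_P,C_P,D_P)$ be a real finite-dimensional linear time-invariant system with $n_u$ inputs, $n_y$ outputs and $n$ states (so $A_P\in\mathbb R^{n\times n}$, $B_P\in\mathbb R^{n\times n_u}$, $C_P\in\mathbb R^{n_y\times n}$, $D_P\in\mathbb R^{n_y\times n_u}$), and let $\mathrm{Adm}\subseteq\{1,\dots,n_u\}\times\{1,\dots,n_y\}$ be a set of admissible index pairs. Let $\mathcal S$ be the set of static controllers $K\in\mathbb R^{n_u\times n_y}$ with $K_{ij}=0$ for all $(i,j)\notin\mathrm{Adm}$. A static controller $K$ is well posed for $P$ if $I-KD_P$ is invertible; then, with $M=(I-KD_P)^{-1}$ and $N=(I-D_PK)^{-1}$, closing $K$ around $P$ gives the system with state-space representation $(A_P+B_PMKC_P,\;B_PM,\;NC_P,\;D_PM)$. The modes of a system are the complex eigenvalues of its dynamics matrix, with algebraic multiplicities; a mode $\lambda$ is unstable if $\operatorname{Re}\lambda\ge 0$. The fixed modes of $P$ with respect to $\mathcal S$ are the $\lambda\in\mathbb C$ that are eigenvalues of $A_P+B_P(I-KD_P)^{-1}KC_P$ for every well-posed $K\in\mathcal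 S$. Let $\Lambda^+(P)$ be the set of unstable modes of $P$ that are not fixed, and let $\nu(P)$ be the sum of their multiplicities. For a SISO system, $\Lambda^+$ and $\nu$ are taken with respect to all static controllers $K\in\mathbb R$. For a system $(A,B,C,D)$ let $\mathcal R$ be the reachable subspace (the complex span of the columns of all $A^kB$, $k\ge0$) and $\mathcal N=\bigcap_{k\ge0}\ker CA^k$ the unobservable subspace. Its uncontrollable modes are the eigenvalues of the map induced by $A$ on $\mathbb C^n/\mathcal R$, its unobservable modes are the eigenvalues of $A|_{\mathcal N}$, and the modes of its controllable and observable part are the eigenvalues of the map induced by $A$ on $\mathcal R/(\mathcal R\cap\mathcal N)$ (the first diagonal block of the Kalman canonical form). **Theorem.** Suppose that $\Lambda^+(P)\neq\varnothing$ and that every fixed mode of $P$ with respect to $\mathcal S$ lies in the open left half-plane. Then there are a $D_K\in\mathcal S$ that is well posed for $P$ and an admissible pair $(i_m,j_m)\in\mathrm{Adm}$ such that the SISO system $$P_m=\bigl(A_P+B_PMD_KC_P,\;\;B_PMe_{i_m},\;\;e_{j_m}^TNC_P,\;\;e_{j_m}^TD_PMe_{i_m}\bigr),\qquad M=(I-D_KD_P)^{-1},\quad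 N=(I-D_PD_K)^{-1},$$ from input $i_m$ to output $j_m$ after closing $D_K$ around $P$, satisfies: 1. There is an $\alpha\in\Lambda^+(P)$ that is a controllable and observable mode of $P_m$: it is a mode of the controllable and observable part of $P_m$, and it is neither an uncontrollable nor an unobservable mode of $P_m$. 2. $P_m$ has no more unstable modes than $P$: $\nu(P_m)\le\nu(P)$, and the total number of unstable modes of $P_m$, counted with multiplicity, is at most that of $P$. -/

import Mathlib

open Matrix

/-- A finite-dimensional linear time-invariant system with `n` states, `p` inputs and `q` outputs,
given by a real state-space representation `(A, B, C, D)`. -/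
@[ext] structure LTISystem (n p q : ℕ) where
  A : Matrix (Fin n) (Fin n) ℝ
  B : Matrix (Fin n) (Fin p) ℝ
  C : Matrix (Fin q) (Fin n) ℝ
  D : Matrix (Fin q) (Fin p) ℝ

/-- The static controllers obeying the information constraint with admissible index set `Adm`:
real gain matrices (from the `q` measurements to the `p` control inputs) whose entries vanish
outside `Adm`. -/
def staticControllers {p q : ℕ} (Adm : Set (Fin p × Fin q)) : Set (Matrix (Fin p) (Fin q) ℝ) :=
  {K | ∀ i j, (i, j) ∉ Adm → K i j = 0}

namespace LTISystem

variable {n p q : ℕ}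

/-! ### Modes -/

/-- The dynamics matrix acting on the complexified state space. -/
noncomputable def stateMap (P : LTISystem n p q) : Module.End ℂ (Fin n → ℂ) :=
  Matrix.toLin' (P.A.map Complex.ofReal)

/-- The input matrix acting on complexified inputs. -/
noncomputable def inputMap (P : LTISystem n p q) : (Fin p → ℂ) →ₗ[ℂ] (Fin n → ℂ) :=
  Matrix.toLin' (P.B.map Complex.ofReal)

/-- The output matrix acting on the complexified state space. -/
noncomputable def outputMap (P : LTISystem n p q) : (Fin n → ℂ) →ₗ[ℂ] (Fin q → ℂ) :=
  Matrix.toLin' (P.C.map Complex.ofReal)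

/-- The (open-loop) modes: the complex eigenvalues of the dynamics matrix. -/
def modes (P : LTISystem n p q) : Set ℂ := {z | P.stateMap.HasEigenvalue z}

/-- The characteristic polynomial of the dynamics matrix, over `ℂ`. -/
noncomputable def modePoly (P : LTISystem n p q) : Polynomial ℂ :=
  (P.A.map Complex.ofReal).charpoly

/-- The (algebraic) multiplicity of a mode. -/
noncomputable def multiplicity (P : LTISystem n p q) (z : ℂ) : ℕ := P.modePoly.rootMultiplicity z

/-! ### Static output feedback -/

/-- The feedback interconnection of `P` with the static gain `K` is well posed. -/
def WellPosed (P : LTISystem n p q) (K : Matrix (Fin p) (Fin q) ℝ) : Prop :=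
  IsUnit (1 - K * P.D)

/-- The map from reference inputs to outputs of `P` when the static gain `K` is closed around `P`
(meaningful when the interconnection is well posed), with `M = (I - K D)⁻¹` and
`N = (I - D K)⁻¹`. -/
noncomputable def closedLoop (P : LTISystem n p q) (K : Matrix (Fin p) (Fin q) ℝ) :
    LTISystem n p q where
  A := P.A + P.B * (1 - K * P.D)⁻¹ * K * P.C
  B := P.B * (1 - K * P.D)⁻¹
  C := (1 - P.D * K)⁻¹ * P.C
  D := P.D * (1 - K * P.D)⁻¹

/-- The SISO system from the `i`-th input to the `j`-th output. -/
def siso (P : LTISystem n p q) (i : Fin p) (j : Fin q) : LTISystem n 1 1 where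
  A := P.A
  B := P.B.submatrix id (fun _ => i)
  C := P.C.submatrix (fun _ => j) id
  D := P.D.submatrix (fun _ => j) (fun _ => i)

/-! ### Fixed and non-fixed modes -/

/-- The fixed modes with respect to static controllers with admissible index set `Adm`. -/
def fixedModes (P : LTISystem n p q) (Adm : Set (Fin p × Fin q)) : Set ℂ :=
  {z | ∀ K ∈ staticControllers Adm, P.WellPosed K → z ∈ (P.closedLoop K).modes}

/-- The unstable (closed right half-plane) non-fixed modes. -/
def unstableNonFixedModes (P : LTISystem n p q) (Adm : Set (Fin p × Fin q)) : Set ℂ :=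
  {z | z ∈ P.modes ∧ 0 ≤ z.re ∧ z ∉ P.fixedModes Adm}

open Classical in
/-- The total number, with multiplicities, of unstable non-fixed modes. -/
noncomputable def numUnstableNonFixed (P : LTISystem n p q) (Adm : Set (Fin p × Fin q)) : ℕ :=
  ∑ z ∈ P.modePoly.roots.toFinset with z ∈ P.unstableNonFixedModes Adm, P.multiplicity z

open Classical in
/-- The total number, with multiplicities, of all unstable modes. -/
noncomputable def numUnstable (P : LTISystem n p q) : ℕ :=
  ∑ z ∈ P.modePoly.roots.toFinset with 0 ≤ z.re, P.multiplicity z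

/-! ### Kalman decomposition -/

/-- The reachable subspace, spanned by the columns of `B, A B, A² B, …`. -/
noncomputable def reachable (P : LTISystem n p q) : Submodule ℂ (Fin n → ℂ) :=
  ⨆ k : ℕ, LinearMap.range ((P.stateMap ^ k) ∘ₗ P.inputMap)

/-- The unobservable subspace, the common kernel of `C, C A, C A², …`. -/
noncomputable def unobservable (P : LTISystem n p q) : Submodule ℂ (Fin n → ℂ) :=
  ⨅ k : ℕ, LinearMap.ker (P.outputMap ∘ₗ (P.stateMap ^ k))

theorem stateMap_mem_reachable (P : LTISystem n p q) :
    ∀ x ∈ P.reachable, P.stateMap x ∈ P.reachable := by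
  suffices h : P.reachable ≤ P.reachable.comap P.stateMap from fun x hx => h hx
  refine iSup_le fun k => ?_
  rintro _ ⟨u, rfl⟩
  refine Submodule.mem_iSup_of_mem (k + 1) ⟨u, ?_⟩
  simp [pow_succ']

theorem stateMap_mem_unobservable (P : LTISystem n p q) :
    ∀ x ∈ P.unobservable, P.stateMap x ∈ P.unobservable := by
  intro x hx
  simp only [unobservable, Submodule.mem_iInf, LinearMap.mem_ker, LinearMap.comp_apply] at hx ⊢
  intro k
  simpa [pow_succ] using hx (k + 1)

/-- The dynamics induced on the state space modulo the reachable subspace (the uncontrollable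
blocks, third and fourth diagonal blocks of the Kalman canonical form). -/
noncomputable def uncontrollableMap (P : LTISystem n p q) :
    Module.End ℂ ((Fin n → ℂ) ⧸ P.reachable) :=
  P.reachable.mapQ P.reachable P.stateMap P.stateMap_mem_reachable

/-- The dynamics restricted to the unobservable subspace (the unobservable blocks, second and
fourth diagonal blocks of the Kalman canonical form). -/
noncomputable def unobservableMap (P : LTISystem n p q) : Module.End ℂ P.unobservable :=
  P.stateMap.restrict P.stateMap_mem_unobservable

/-- The dynamics induced on the reachable subspace modulo its unobservable vectors (the
controllable and observable block, first diagonal block of the Kalman canonical form). -/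
noncomputable def controllableObservableMap (P : LTISystem n p q) :
    Module.End ℂ (P.reachable ⧸ P.unobservable.submoduleOf P.reachable) :=
  (P.unobservable.submoduleOf P.reachable).mapQ (P.unobservable.submoduleOf P.reachable)
    (P.stateMap.restrict P.stateMap_mem_reachable)
    (fun x hx => P.stateMap_mem_unobservable x hx)

/-- The uncontrollable modes. -/
def uncontrollableModes (P : LTISystem n p q) : Set ℂ := {z | P.uncontrollableMap.HasEigenvalue z}

/-- The unobservable modes. -/
def unobservableModes (P : LTISystem n p q) : Set ℂ := {z | P.unobservableMap.HasEigenvalue z}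

/-- The modes of the controllable and observable part. -/
def controllableObservableModes (P : LTISystem n p q) : Set ℂ :=
  {z | P.controllableObservableMap.HasEigenvalue z}

end LTISystem

/-!
All unstable modes are non-fixed, so it suffices to find a gain `DK` and an entry `(i, j)` such that
closing `DK` does not increase the number of unstable modes and some unstable mode `α` of the open
loop is still a mode, but neither an uncontrollable nor an unobservable one of the `(i, j)` channel.

Since `α` is not fixed, some admissible well-posed gain `K` moves it. Up to a nonzero factor, the
characteristic polynomial of the loop closed by `t • K`, evaluated at `α`, is the determinant of a
matrix that is affine in `t` (`Matrix.det_fromBlocks_eq_mul_eval_charpoly`); hence arbitrarily small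
multiples of `K` still move `α` (`LTISystem.eventually_notMem_modes_closedLoop_smul`). By upper
semicontinuity of the number of eigenvalues in a closed set
(`Matrix.eventually_card_filter_roots_charpoly_le`), all the gains obtained from a small multiple
of `K` by deleting entries are well posed and create no new unstable modes.

Now switch on the entries of this small gain one at a time. At first `α` is a mode and at the end it
is not, so there is a partial gain `DK` that keeps `α` and a further entry `(i, j)` that moves it.
Feedback through `(i, j)` cannot move the uncontrollable or unobservable modes of the `(i, j)`
channel (`LTISystem.mem_modes_of_mem_uncontrollableModes`,
`LTISystem.mem_modes_of_mem_unobservableModes`), so `α` is neither.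
An eigenvector for `α` then survives in the controllable and observable part.
-/

open Filter Topology Polynomial

/-! ### Semicontinuity of the number of eigenvalues in a closed set -/

theorem Matrix.norm_le_sum_of_isRoot_charpoly {n : ℕ} {A : Matrix (Fin n) (Fin n) ℂ} {z : ℂ}
    (hz : A.charpoly.IsRoot z) : ‖z‖ ≤ ∑ i, ∑ j, ‖A i j‖ := by
  have hev : Module.End.HasEigenvalue (Matrix.toLin' A) z := by
    rw [Module.End.hasEigenvalue_iff_isRoot_charpoly, Matrix.charpoly_toLin']
    exact hz
  obtain ⟨k, hk⟩ := eigenvalue_mem_ball hev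
  rw [mem_closedBall_iff_norm] at hk
  have hrow : ‖A k k‖ + ∑ j ∈ Finset.univ.erase k, ‖A k j‖ = ∑ j, ‖A k j‖ :=
    Finset.add_sum_erase _ (fun j => ‖A k j‖) (Finset.mem_univ k)
  have hsum : ∑ j, ‖A k j‖ ≤ ∑ i, ∑ j, ‖A i j‖ :=
    Finset.single_le_sum (f := fun i => ∑ j, ‖A i j‖)
      (fun i _ => Finset.sum_nonneg fun j _ => norm_nonneg _) (Finset.mem_univ k)
  have htri : ‖z‖ ≤ ‖z - A k k‖ + ‖A k k‖ := by
    simpa using norm_add_le (z - A k k) (A k k)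
  linarith

theorem Matrix.exists_roots_charpoly_eq_map {n : ℕ} (A : Matrix (Fin n) (Fin n) ℂ) :
    ∃ z : Fin n → ℂ, A.charpoly.roots = Finset.univ.val.map z := by
  have hcard : A.charpoly.roots.card = n := by
    rw [IsAlgClosed.card_roots_eq_natDegree, Matrix.charpoly_natDegree_eq_dim, Fintype.card_fin]
  obtain ⟨l, hl⟩ := Quot.exists_rep A.charpoly.roots
  have hl' : A.charpoly.roots = (l : Multiset ℂ) := hl.symm
  rw [hl', Multiset.coe_card] at hcard
  subst hcard
  exact ⟨l.get, by rw [hl', Fin.univ_val_map, List.ofFn_get]⟩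

theorem Matrix.eval_charpoly_eq_prod {n : ℕ} {A : Matrix (Fin n) (Fin n) ℂ} {z : Fin n → ℂ}
    (hz : A.charpoly.roots = Finset.univ.val.map z) (x : ℂ) :
    A.charpoly.eval x = ∏ i, (x - z i) := by
  rw [(IsAlgClosed.splits A.charpoly).eq_prod_roots_of_monic A.charpoly_monic, hz,
    eval_multiset_prod]
  simp [Finset.prod, Function.comp_def]

/-- The number of eigenvalues in a closed set, counted with multiplicity, is upper semicontinuous:
ordered tuples of eigenvalues of a convergent sequence of matrices stay bounded, and the limit of
any convergent subsequence lists the eigenvalues of the limit. -/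
theorem Matrix.eventually_card_filter_roots_charpoly_le {n : ℕ} (A : Matrix (Fin n) (Fin n) ℂ)
    (s : ℂ → Prop) [DecidablePred s] (hs : IsClosed {z | s z}) :
    ∀ᶠ A' in 𝓝 A, (A'.charpoly.roots.filter s).card ≤ (A.charpoly.roots.filter s).card := by
  by_contra hcon
  rw [not_eventually] at hcon
  have : FirstCountableTopology (Matrix (Fin n) (Fin n) ℂ) :=
    inferInstanceAs (FirstCountableTopology (Fin n → Fin n → ℂ))
  obtain ⟨F, hF, hFcard⟩ := exists_seq_forall_of_frequently hcon
  choose z hz using fun m => (F m).exists_roots_charpoly_eq_map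
  have hentry : ∀ i j, Tendsto (fun m => F m i j) atTop (𝓝 (A i j)) := fun i j =>
    ((continuous_apply_apply i j).tendsto A).comp hF
  have hbound : Tendsto (fun m => ∑ i, ∑ j, ‖F m i j‖) atTop (𝓝 (∑ i, ∑ j, ‖A i j‖)) :=
    tendsto_finsetSum _ fun i _ => tendsto_finsetSum _ fun j _ => (hentry i j).norm
  obtain ⟨R, hR⟩ := hbound.bddAbove_range
  have hzR : ∀ m, z m ∈ Metric.closedBall (0 : Fin n → ℂ) R := by
    intro m
    have hle : ∑ i, ∑ j, ‖F m i j‖ ≤ R := hR ⟨m, rfl⟩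
    have hR0 : 0 ≤ R :=
      (Finset.sum_nonneg fun i _ => Finset.sum_nonneg fun j _ => norm_nonneg _).trans hle
    rw [mem_closedBall_zero_iff, pi_norm_le_iff_of_nonneg hR0]
    intro i
    refine (Matrix.norm_le_sum_of_isRoot_charpoly ?_).trans hle
    apply isRoot_of_mem_roots
    rw [hz m]
    exact Multiset.mem_map_of_mem _ (Finset.mem_univ i)
  obtain ⟨w, -, φ, hφ, hw⟩ := (isCompact_closedBall (0 : Fin n → ℂ) R).tendsto_subseq hzR
  have hwi : ∀ i, Tendsto (fun m => z (φ m) i) atTop (𝓝 (w i)) := fun i =>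
    ((continuous_apply i).tendsto w).comp hw
  have hpoly : A.charpoly = ∏ i, (X - C (w i)) := by
    refine Polynomial.funext fun x => ?_
    rw [eval_prod]
    simp only [eval_sub, eval_X, eval_C]
    have hlim : Tendsto (fun m => (F (φ m)).charpoly.eval x) atTop (𝓝 (A.charpoly.eval x)) := by
      simp only [Matrix.eval_charpoly]
      have hcont : Continuous fun M : Matrix (Fin n) (Fin n) ℂ => (scalar (Fin n) x - M).det :=
        (continuous_const.sub continuous_id).matrix_det
      exact (hcont.tendsto A).comp (hF.comp hφ.tendsto_atTop)
    refine tendsto_nhds_unique hlim ?_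
    simp only [fun m => Matrix.eval_charpoly_eq_prod (hz (φ m)) x]
    exact tendsto_finsetProd _ fun i _ => tendsto_const_nhds.sub (hwi i)
  have hroots : A.charpoly.roots = Finset.univ.val.map w := by
    rw [hpoly, ← roots_multiset_prod_X_sub_C (Finset.univ.val.map w), Multiset.map_map]
    rfl
  -- indices whose limit lies outside the closed set are eventually outside it
  have hev : ∀ᶠ m in atTop, ∀ i, ¬ s (w i) → ¬ s (z (φ m) i) := by
    refine eventually_all.2 fun i => ?_
    by_cases hi : s (w i)
    · exact Eventually.of_forall fun _ h => absurd hi h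
    · exact ((hwi i).eventually (hs.isOpen_compl.mem_nhds hi)).mono fun _ h _ => h
  obtain ⟨m, hm⟩ := hev.exists
  refine hFcard (φ m) ?_
  rw [hz (φ m), hroots, Multiset.filter_map, Multiset.filter_map, Multiset.card_map,
    Multiset.card_map]
  exact Multiset.card_le_card (Multiset.monotone_filter_right _ fun i h => by
    by_contra hi
    exact hm i hi h)

/-! ### Eigenvalues of perturbed endomorphisms -/

/-- In finite dimension an eigenvalue of a quotient of `g` by an invariant subspace is an
eigenvalue of every `f` that induces the same map on that quotient. -/
theorem Module.End.HasEigenvalue.of_mapQ {V : Type*} [AddCommGroup V] [Module ℂ V]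
    [FiniteDimensional ℂ V] {W : Submodule ℂ V} {f g : Module.End ℂ V} (hg : W ≤ W.comap g)
    (hfg : ∀ x, f x - g x ∈ W) {a : ℂ} (ha : Module.End.HasEigenvalue (W.mapQ W g hg) a) :
    f.HasEigenvalue a := by
  rw [Module.End.hasEigenvalue_iff_mem_spectrum, spectrum.mem_iff] at ha ⊢
  intro hunit
  refine ha ((LinearMap.isUnit_iff_range_eq_top _).2 (LinearMap.range_eq_top.2 fun y => ?_))
  obtain ⟨y, rfl⟩ := W.mkQ_surjective y
  obtain ⟨x, hx⟩ :=
    LinearMap.range_eq_top.1 ((LinearMap.isUnit_iff_range_eq_top _).1 hunit) y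
  refine ⟨W.mkQ x, ?_⟩
  simp only [LinearMap.sub_apply, Module.algebraMap_end_apply, Submodule.mkQ_apply,
    Submodule.mapQ_apply] at hx ⊢
  rw [← hx, ← Submodule.Quotient.mk_smul, ← Submodule.Quotient.mk_sub,
    Submodule.Quotient.eq]
  simpa using hfg x

/-! ### Closed loops along a line of gains -/

/-- The Schur complement formula that clears the inverse from the characteristic polynomial of a
closed loop. -/
theorem Matrix.det_fromBlocks_eq_mul_eval_charpoly {n p q : ℕ} {R : Type*} [CommRing R]
    (A : Matrix (Fin n) (Fin n) R) (B : Matrix (Fin n) (Fin p) R) (C : Matrix (Fin q) (Fin n) R)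
    (D : Matrix (Fin q) (Fin p) R) (K : Matrix (Fin p) (Fin q) R) (M : Matrix (Fin p) (Fin p) R)
    (hM : M * (1 - K * D) = 1) (z : R) :
    (fromBlocks (scalar (Fin n) z - A) (-B) (-(K * C)) (1 - K * D)).det =
      (1 - K * D).det * (A + B * M * K * C).charpoly.eval z := by
  let _ : Invertible (1 - K * D) := ⟨M, hM, mul_eq_one_comm.1 hM⟩
  rw [det_fromBlocks₂₂, Matrix.eval_charpoly]
  congr 2
  have hinv : ⅟(1 - K * D) = M := rfl
  rw [hinv]
  simp only [Matrix.neg_mul, Matrix.mul_neg, neg_neg, Matrix.mul_assoc]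
  abel

theorem Matrix.eventually_det_add_smul_ne_zero {ι : Type*} [Fintype ι] [DecidableEq ι]
    (M₀ M₁ : Matrix ι ι ℂ) (h : (M₀ + M₁).det ≠ 0) :
    ∀ᶠ t : ℝ in 𝓝[≠] 0, (M₀ + (t : ℂ) • M₁).det ≠ 0 := by
  let f : ℂ[X] := (M₀.map C + M₁.map fun a => X * C a).det
  have hf : ∀ t : ℂ, f.eval t = (M₀ + t • M₁).det := by
    intro t
    change evalRingHom t _ = _
    rw [RingHom.map_det]
    congr 1
    ext i j
    simp
    ring
  have hf0 : f ≠ 0 := by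
    intro h0
    have := hf 1
    rw [h0, eval_zero, one_smul] at this
    exact h this.symm
  have hfin : {t : ℝ | f.IsRoot t}.Finite :=
    (finite_setOfPred_isRoot hf0).preimage Complex.ofReal_injective.injOn
  filter_upwards [nhdsNE_le_cofinite 0 hfin.compl_mem_cofinite] with t ht
  rw [← hf]
  exact ht

theorem Matrix.isUnit_one_sub_mul_swap {p q : ℕ} {D : Matrix (Fin q) (Fin p) ℝ}
    {K : Matrix (Fin p) (Fin q) ℝ} (h : IsUnit (1 - K * D)) : IsUnit (1 - D * K) := by
  rw [Matrix.isUnit_iff_isUnit_det] at h ⊢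
  rwa [← Matrix.det_one_sub_mul_comm]

/-- The change of the effective gain `(1 - K D)⁻¹ K` has `K' - K` as its middle factor. The left
factor belongs to the loop of `K` and the right one to that of `K'`; exchanging `K` and `K'` swaps
these roles. -/
theorem Matrix.inv_one_sub_mul_mul_sub {p q : ℕ} {D : Matrix (Fin q) (Fin p) ℝ}
    {K K' : Matrix (Fin p) (Fin q) ℝ} (h : IsUnit (1 - K * D)) (h' : IsUnit (1 - K' * D)) :
    (1 - K' * D)⁻¹ * K' - (1 - K * D)⁻¹ * K =
      (1 - K * D)⁻¹ * (K' - K) * (1 - D * K')⁻¹ := by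
  have h₁ : (1 - K * D)⁻¹ * (1 - K * D) = 1 :=
    Matrix.nonsing_inv_mul _ ((Matrix.isUnit_iff_isUnit_det _).1 h)
  have h₂ : (1 - K' * D)⁻¹ * (1 - K' * D) = 1 :=
    Matrix.nonsing_inv_mul _ ((Matrix.isUnit_iff_isUnit_det _).1 h')
  have h₃ : (1 - D * K') * (1 - D * K')⁻¹ = 1 :=
    Matrix.mul_nonsing_inv _ ((Matrix.isUnit_iff_isUnit_det _).1 (isUnit_one_sub_mul_swap h'))
  have hpush : (1 - K' * D)⁻¹ * K' = K' * (1 - D * K')⁻¹ :=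
    calc (1 - K' * D)⁻¹ * K'
        = (1 - K' * D)⁻¹ * (K' * ((1 - D * K') * (1 - D * K')⁻¹)) := by
          rw [h₃, Matrix.mul_one]
      _ = ((1 - K' * D)⁻¹ * (1 - K' * D)) * (K' * (1 - D * K')⁻¹) := by
          simp only [Matrix.mul_sub, Matrix.sub_mul, Matrix.mul_one, Matrix.one_mul,
            Matrix.mul_assoc]
      _ = K' * (1 - D * K')⁻¹ := by rw [h₂, Matrix.one_mul]
  calc (1 - K' * D)⁻¹ * K' - (1 - K * D)⁻¹ * K
      = ((1 - K * D)⁻¹ * (1 - K * D)) * (K' * (1 - D * K')⁻¹) -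
          (1 - K * D)⁻¹ * (K * ((1 - D * K') * (1 - D * K')⁻¹)) := by
        rw [h₁, h₃, Matrix.one_mul, Matrix.mul_one, hpush]
    _ = (1 - K * D)⁻¹ * (K' - K) * (1 - D * K')⁻¹ := by
      simp only [Matrix.mul_sub, Matrix.sub_mul, Matrix.mul_one, Matrix.one_mul, Matrix.mul_assoc]
      abel

theorem Matrix.mul_single_mul_eq_submatrix {l m n o : Type*} [Fintype m] [Fintype n]
    [DecidableEq m] [DecidableEq n] (X : Matrix l m ℝ) (i : m) (j : n) (c : ℝ)
    (Y : Matrix n o ℝ) :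
    X * Matrix.single i j c * Y =
      X.submatrix id (fun _ : Fin 1 => i) * c • Y.submatrix (fun _ : Fin 1 => j) id := by
  ext a b
  rw [Matrix.mul_assoc, Matrix.mul_apply, Finset.sum_eq_single i]
  · rw [Matrix.single_mul_apply_same]
    simp [Matrix.mul_apply]
  · intro k _ hk
    rw [Matrix.single_mul_apply_of_ne _ _ _ _ _ hk, mul_zero]
  · simp

namespace LTISystem

/-! ### Modes and their number -/

theorem mem_modes_iff_isRoot {n p q : ℕ} (P : LTISystem n p q) (z : ℂ) :
    z ∈ P.modes ↔ P.modePoly.IsRoot z := by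
  rw [modes, Set.mem_ofPred_eq, Module.End.hasEigenvalue_iff_isRoot_charpoly, stateMap,
    Matrix.charpoly_toLin', modePoly]

theorem numUnstable_eq_card {n p q : ℕ} (P : LTISystem n p q) :
    P.numUnstable = (P.modePoly.roots.filter fun z => 0 ≤ z.re).card := by
  classical
  rw [← Multiset.toFinset_sum_count_eq, Multiset.toFinset_filter, numUnstable]
  refine Finset.sum_congr (by congr!) fun z hz => ?_
  rw [Multiset.count_filter_of_pos (p := fun z : ℂ => 0 ≤ z.re) (Finset.mem_filter.1 hz).2,
    count_roots, multiplicity]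

theorem numUnstableNonFixed_le_numUnstable {n p q : ℕ} (P : LTISystem n p q)
    (Adm : Set (Fin p × Fin q)) : P.numUnstableNonFixed Adm ≤ P.numUnstable := by
  classical
  exact Finset.sum_le_sum_of_subset fun z hz => by
    rw [Finset.mem_filter] at hz ⊢
    exact ⟨hz.1, hz.2.2.1⟩

theorem numUnstableNonFixed_eq_numUnstable {n p q : ℕ} {P : LTISystem n p q}
    {Adm : Set (Fin p × Fin q)} (hfixed : P.fixedModes Adm ⊆ {z : ℂ | z.re < 0}) :
    P.numUnstableNonFixed Adm = P.numUnstable := by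
  classical
  refine le_antisymm (P.numUnstableNonFixed_le_numUnstable Adm) ?_
  exact Finset.sum_le_sum_of_subset fun z hz => by
    rw [Finset.mem_filter] at hz ⊢
    refine ⟨hz.1, (P.mem_modes_iff_isRoot z).2 ?_, hz.2, fun h => absurd (hfixed h) hz.2.not_gt⟩
    exact isRoot_of_mem_roots (Multiset.mem_toFinset.1 hz.1)

/-! ### Small gains along a ray -/

theorem closedLoop_zero {n p q : ℕ} (P : LTISystem n p q) : P.closedLoop 0 = P := by
  ext <;> simp [closedLoop]

theorem eventually_wellPosed_smul {n p q : ℕ} (P : LTISystem n p q)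
    (K : Matrix (Fin p) (Fin q) ℝ) : ∀ᶠ t : ℝ in 𝓝 0, P.WellPosed (t • K) := by
  have hcont : Continuous fun t : ℝ => (1 - t • K * P.D).det := by fun_prop
  have h0 : (fun t : ℝ => (1 - t • K * P.D).det) 0 ≠ 0 := by simp
  filter_upwards [hcont.continuousAt.eventually_ne h0] with t ht
  rw [WellPosed, Matrix.isUnit_iff_isUnit_det]
  exact isUnit_iff_ne_zero.2 ht

theorem continuousAt_closedLoop_smul {n p q : ℕ} (P : LTISystem n p q)
    (K : Matrix (Fin p) (Fin q) ℝ) :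
    ContinuousAt (fun t : ℝ => (P.closedLoop (t • K)).A) 0 := by
  have hcont : Continuous fun t : ℝ => 1 - t • K * P.D := by fun_prop
  have hinv : ContinuousAt (fun t : ℝ => (1 - t • K * P.D)⁻¹) 0 := by
    simp only [Matrix.inv_def, Ring.inverse_eq_inv']
    refine ContinuousAt.smul (ContinuousAt.inv₀ hcont.matrix_det.continuousAt ?_)
      hcont.matrix_adjugate.continuousAt
    simp
  have hK : ContinuousAt (fun t : ℝ => t • K) 0 := by fun_prop
  have hmul : Continuous fun X : Matrix (Fin p) (Fin p) ℝ × Matrix (Fin p) (Fin q) ℝ =>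
      P.A + P.B * X.1 * X.2 * P.C := by fun_prop
  change ContinuousAt ((fun X : Matrix (Fin p) (Fin p) ℝ × Matrix (Fin p) (Fin q) ℝ =>
    P.A + P.B * X.1 * X.2 * P.C) ∘ fun t : ℝ => ((1 - t • K * P.D)⁻¹, t • K)) 0
  exact ContinuousAt.comp hmul.continuousAt (hinv.prodMk hK)

/-- Small gains do not create unstable modes, because the closed right half-plane is closed. -/
theorem eventually_numUnstable_closedLoop_smul_le {n p q : ℕ} (P : LTISystem n p q)
    (K : Matrix (Fin p) (Fin q) ℝ) :
    ∀ᶠ t : ℝ in 𝓝 0, (P.closedLoop (t • K)).numUnstable ≤ P.numUnstable := by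
  have hclosed : IsClosed {z : ℂ | 0 ≤ z.re} := isClosed_le continuous_const Complex.continuous_re
  have hmap : Continuous fun A : Matrix (Fin n) (Fin n) ℝ => A.map Complex.ofReal :=
    continuous_id.matrix_map Complex.continuous_ofReal
  have hlim := hmap.continuousAt.comp (P.continuousAt_closedLoop_smul K)
  have hev := hlim.eventually
    (Matrix.eventually_card_filter_roots_charpoly_le _ (fun z : ℂ => 0 ≤ z.re) hclosed)
  filter_upwards [hev] with t ht
  rw [numUnstable_eq_card, numUnstable_eq_card]
  simpa only [modePoly, Function.comp_apply, zero_smul, closedLoop_zero] using ht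

theorem mem_modes_closedLoop_iff_det_eq_zero {n p q : ℕ} {P : LTISystem n p q}
    {K : Matrix (Fin p) (Fin q) ℝ} (hK : P.WellPosed K) (z : ℂ) :
    z ∈ (P.closedLoop K).modes ↔
      (fromBlocks (scalar (Fin n) z - P.A.map Complex.ofReal) (-P.B.map Complex.ofReal)
        (-(K.map Complex.ofReal * P.C.map Complex.ofReal))
        (1 - K.map Complex.ofReal * P.D.map Complex.ofReal)).det = 0 := by
  have hM : (1 - K * P.D)⁻¹.map Complex.ofReal *
      (1 - K.map Complex.ofReal * P.D.map Complex.ofReal) = 1 := by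
    have h := congrArg (fun X => X.map Complex.ofRealHom)
      (Matrix.nonsing_inv_mul _ ((Matrix.isUnit_iff_isUnit_det _).1 hK))
    rw [Matrix.map_mul, Matrix.map_sub _ (map_sub _), Matrix.map_mul,
      Matrix.map_one _ (map_zero _) (map_one _)] at h
    exact h
  have hA : (P.closedLoop K).A.map Complex.ofReal = P.A.map Complex.ofReal +
      P.B.map Complex.ofReal * (1 - K * P.D)⁻¹.map Complex.ofReal * K.map Complex.ofReal *
        P.C.map Complex.ofReal := by
    change (P.A + P.B * (1 - K * P.D)⁻¹ * K * P.C).map Complex.ofRealHom = _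
    simp only [Matrix.map_mul, Matrix.map_add _ (map_add _)]
    rfl
  rw [Matrix.det_fromBlocks_eq_mul_eval_charpoly _ _ _ _ _ _ hM, ← hA,
    mul_eq_zero_iff_left (Matrix.isUnit_det_of_left_inverse hM).ne_zero, mem_modes_iff_isRoot]
  rfl

/-- A gain that moves `z` still moves it after almost every rescaling. -/
theorem eventually_notMem_modes_closedLoop_smul {n p q : ℕ} {P : LTISystem n p q}
    {K : Matrix (Fin p) (Fin q) ℝ} (hK : P.WellPosed K) {z : ℂ}
    (hz : z ∉ (P.closedLoop K).modes) :
    ∀ᶠ t : ℝ in 𝓝[≠] 0, z ∉ (P.closedLoop (t • K)).modes := by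
  rw [mem_modes_closedLoop_iff_det_eq_zero hK] at hz
  have hev := Matrix.eventually_det_add_smul_ne_zero
    (fromBlocks (scalar (Fin n) z - P.A.map Complex.ofReal) (-P.B.map Complex.ofReal) 0 1)
    (fromBlocks 0 0 (-(K.map Complex.ofReal * P.C.map Complex.ofReal))
      (-(K.map Complex.ofReal * P.D.map Complex.ofReal)))
    (by simpa [fromBlocks_add, ← sub_eq_add_neg] using hz)
  filter_upwards [hev, (P.eventually_wellPosed_smul K).filter_mono nhdsWithin_le_nhds]
    with t ht hwp
  rw [mem_modes_closedLoop_iff_det_eq_zero hwp]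
  have hsmul : (t • K).map Complex.ofReal = (t : ℂ) • K.map Complex.ofReal := by
    ext
    simp
  simpa [fromBlocks_add, fromBlocks_smul, hsmul, ← sub_eq_add_neg] using ht

/-! ### Modes that a single feedback entry cannot move -/

theorem stateMap_closedLoop_sub {n p q : ℕ} {P : LTISystem n p q}
    {K K' : Matrix (Fin p) (Fin q) ℝ} (hK : P.WellPosed K) (hK' : P.WellPosed K')
    {i : Fin p} {j : Fin q} {c : ℝ} (hc : K' - K = Matrix.single i j c) (x : Fin n → ℂ) :
    (P.closedLoop K').stateMap x - (P.closedLoop K).stateMap x =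
      (((P.B * (1 - K * P.D)⁻¹).submatrix id fun _ : Fin 1 => i).map Complex.ofReal) *ᵥ
        ((c • ((1 - P.D * K')⁻¹ * P.C).submatrix (fun _ : Fin 1 => j) id).map Complex.ofReal *ᵥ
          x) := by
  have hA : (P.closedLoop K').A - (P.closedLoop K).A =
      (P.B * (1 - K * P.D)⁻¹).submatrix id (fun _ : Fin 1 => i) *
        (c • ((1 - P.D * K')⁻¹ * P.C).submatrix (fun _ : Fin 1 => j) id :
          Matrix (Fin 1) (Fin n) ℝ) := by
    rw [← Matrix.mul_single_mul_eq_submatrix, ← hc]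
    calc (P.closedLoop K').A - (P.closedLoop K).A
        = P.B * ((1 - K' * P.D)⁻¹ * K' - (1 - K * P.D)⁻¹ * K) * P.C := by
          simp only [closedLoop, Matrix.mul_sub, Matrix.sub_mul, Matrix.mul_assoc]
          abel
      _ = P.B * (1 - K * P.D)⁻¹ * (K' - K) * ((1 - P.D * K')⁻¹ * P.C) := by
          rw [Matrix.inv_one_sub_mul_mul_sub hK hK']
          simp only [Matrix.mul_assoc]
  have hmap := congrArg (fun X => X.map Complex.ofRealHom) hA
  simp only [Matrix.map_mul] at hmap
  rw [Matrix.mulVec_mulVec]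
  change _ = (Matrix.map _ Complex.ofRealHom * Matrix.map _ Complex.ofRealHom) *ᵥ x
  rw [← hmap, Matrix.map_sub _ (map_sub _), Matrix.sub_mulVec]
  simp only [stateMap, Matrix.toLin'_apply]
  rfl

theorem inputMap_mem_reachable {n p q : ℕ} (P : LTISystem n p q) (u : Fin p → ℂ) :
    P.inputMap u ∈ P.reachable :=
  Submodule.mem_iSup_of_mem 0 ⟨u, by simp⟩

/-- Feedback through the `(i, j)` entry acts inside the reachable subspace of the corresponding
SISO system, so it leaves the dynamics modulo that subspace unchanged. -/
theorem mem_modes_of_mem_uncontrollableModes {n p q : ℕ} {P : LTISystem n p q}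
    {K K' : Matrix (Fin p) (Fin q) ℝ} (hK : P.WellPosed K) (hK' : P.WellPosed K')
    {i : Fin p} {j : Fin q} {c : ℝ} (hc : K' - K = Matrix.single i j c) {a : ℂ}
    (ha : a ∈ ((P.closedLoop K).siso i j).uncontrollableModes) :
    a ∈ (P.closedLoop K').modes := by
  refine Module.End.HasEigenvalue.of_mapQ ((P.closedLoop K).siso i j).stateMap_mem_reachable
    (fun x => ?_) ha
  have hx := stateMap_closedLoop_sub hK hK' hc x
  change (P.closedLoop K').stateMap x - (P.closedLoop K).stateMap x ∈ _
  rw [hx, ← Matrix.toLin'_apply]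
  exact ((P.closedLoop K).siso i j).inputMap_mem_reachable _

/-- Feedback through the `(i, j)` entry vanishes on the unobservable subspace of the corresponding
SISO system, so it leaves the dynamics there unchanged. -/
theorem mem_modes_of_mem_unobservableModes {n p q : ℕ} {P : LTISystem n p q}
    {K K' : Matrix (Fin p) (Fin q) ℝ} (hK : P.WellPosed K) (hK' : P.WellPosed K')
    {i : Fin p} {j : Fin q} {c : ℝ} (hc : K' - K = Matrix.single i j c) {a : ℂ}
    (ha : a ∈ ((P.closedLoop K).siso i j).unobservableModes) :
    a ∈ (P.closedLoop K').modes := by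
  obtain ⟨⟨v, hmem⟩, hv⟩ := Module.End.HasEigenvalue.exists_hasEigenvector ha
  have hav : ((P.closedLoop K).siso i j).stateMap v = a • v :=
    congrArg Subtype.val hv.apply_eq_smul
  change (P.closedLoop K).stateMap v = a • v at hav
  have hout : ((P.closedLoop K).siso i j).outputMap v = 0 := by
    rw [unobservable, Submodule.mem_iInf] at hmem
    exact hmem 0
  -- exchanging the two gains puts the output map of the loop closed by `K` on the right
  have hneg : K - K' = Matrix.single i j (-c) := by
    rw [← neg_sub, hc]
    ext a b
    by_cases hab : i = a ∧ j = b <;> simp [hab]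
  have hx := stateMap_closedLoop_sub hK' hK hneg v
  have hzero : ((-c) • ((1 - P.D * K)⁻¹ * P.C).submatrix (fun _ : Fin 1 => j) id).map
      Complex.ofReal *ᵥ v = 0 := by
    have hsmul : ((-c) • ((1 - P.D * K)⁻¹ * P.C).submatrix (fun _ : Fin 1 => j) id).map
        Complex.ofReal =
        ((-c : ℝ) : ℂ) • ((P.closedLoop K).siso i j).C.map Complex.ofReal := by
      ext
      simp [siso, closedLoop]
    rw [hsmul, Matrix.smul_mulVec, ← Matrix.toLin'_apply]
    exact (congrArg _ hout).trans (smul_zero _)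
  rw [hzero, Matrix.mulVec_zero, sub_eq_zero, hav] at hx
  refine Module.End.hasEigenvalue_of_hasEigenvector (x := v)
    ⟨Module.End.mem_eigenspace_iff.2 hx.symm, fun h => hv.2 (Subtype.ext h)⟩

theorem mem_controllableObservableModes {n p q : ℕ} {P : LTISystem n p q} {a : ℂ}
    (ha : a ∈ P.modes) (hc : a ∉ P.uncontrollableModes) (ho : a ∉ P.unobservableModes) :
    a ∈ P.controllableObservableModes := by
  obtain ⟨v, hv⟩ := Module.End.HasEigenvalue.exists_hasEigenvector ha
  have hreach : v ∈ P.reachable := by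
    by_contra h
    refine hc (Module.End.hasEigenvalue_of_hasEigenvector (x := P.reachable.mkQ v)
      ⟨Module.End.mem_eigenspace_iff.2 ?_, ?_⟩)
    · rw [uncontrollableMap, Submodule.mkQ_apply, Submodule.mapQ_apply, hv.apply_eq_smul,
        Submodule.Quotient.mk_smul]
    · rwa [Submodule.mkQ_apply, Ne, Submodule.Quotient.mk_eq_zero]
  have hobs : v ∉ P.unobservable := by
    intro h
    refine ho (Module.End.hasEigenvalue_of_hasEigenvector (x := ⟨v, h⟩)
      ⟨Module.End.mem_eigenspace_iff.2 (Subtype.ext hv.apply_eq_smul), ?_⟩)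
    exact fun h0 => hv.2 (congrArg Subtype.val h0)
  refine Module.End.hasEigenvalue_of_hasEigenvector
    (x := (P.unobservable.submoduleOf P.reachable).mkQ ⟨v, hreach⟩)
    ⟨Module.End.mem_eigenspace_iff.2 ?_, ?_⟩
  · exact congrArg (P.unobservable.submoduleOf P.reachable).mkQ
      (Subtype.ext hv.apply_eq_smul : P.stateMap.restrict P.stateMap_mem_reachable ⟨v, hreach⟩ =
        a • ⟨v, hreach⟩)
  · rwa [Submodule.mkQ_apply, Ne, Submodule.Quotient.mk_eq_zero]

end LTISystem

/-! ### Switching on the gain entry by entry -/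

/-- A property that holds for the empty set and fails for the whole type is destroyed by the
insertion of some single element. -/
theorem Finset.exists_and_not_insert {ι : Type*} [Fintype ι] [DecidableEq ι]
    {Q : Finset ι → Prop} (h₀ : Q ∅) (h₁ : ¬ Q Finset.univ) :
    ∃ S, ∃ a ∉ S, Q S ∧ ¬ Q (insert a S) := by
  by_contra! h
  exact h₁ (Finset.induction_on Finset.univ h₀ fun a S ha hS => h S a ha hS)

/-- The matrix `K` with the entries outside `S` replaced by zero. -/
def Matrix.restrictEntries {p q : ℕ} (K : Matrix (Fin p) (Fin q) ℝ) (S : Finset (Fin p × Fin q)) :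
    Matrix (Fin p) (Fin q) ℝ :=
  Matrix.of fun i j => if (i, j) ∈ S then K i j else 0

theorem Matrix.restrictEntries_insert_sub {p q : ℕ} (K : Matrix (Fin p) (Fin q) ℝ)
    {S : Finset (Fin p × Fin q)} {i : Fin p} {j : Fin q} (h : (i, j) ∉ S) :
    K.restrictEntries (insert (i, j) S) - K.restrictEntries S = Matrix.single i j (K i j) := by
  ext a b
  by_cases hab : i = a ∧ j = b
  · obtain ⟨rfl, rfl⟩ := hab
    simp [restrictEntries, h]
  · have hne : ¬ (a = i ∧ b = j) := fun h => hab ⟨h.1.symm, h.2.symm⟩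
    simp [restrictEntries, Matrix.single_apply_of_ne _ _ _ _ _ hab, hne]

theorem mainTheorem6 {n p q : ℕ} (P : LTISystem n p q) (Adm : Set (Fin p × Fin q))
    (hunstable : (P.unstableNonFixedModes Adm).Nonempty)
    (hfixed : P.fixedModes Adm ⊆ {z : ℂ | z.re < 0}) :
    ∃ DK ∈ staticControllers Adm, P.WellPosed DK ∧
      ∃ i : Fin p, ∃ j : Fin q, (i, j) ∈ Adm ∧
        (∃ α ∈ P.unstableNonFixedModes Adm,
          α ∈ ((P.closedLoop DK).siso i j).controllableObservableModes ∧
          α ∉ ((P.closedLoop DK).siso i j).uncontrollableModes ∧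
          α ∉ ((P.closedLoop DK).siso i j).unobservableModes) ∧
        ((P.closedLoop DK).siso i j).numUnstableNonFixed Set.univ ≤ P.numUnstableNonFixed Adm ∧
        ((P.closedLoop DK).siso i j).numUnstable ≤ P.numUnstable := by
  obtain ⟨α, hα⟩ := hunstable
  obtain ⟨K, hK, hKwp, hKα⟩ :
      ∃ K ∈ staticControllers Adm, P.WellPosed K ∧ α ∉ (P.closedLoop K).modes := by
    by_contra! h
    exact hα.2.2 h
  have hsmall : ∀ᶠ t : ℝ in 𝓝 0, ∀ S, P.WellPosed (t • K.restrictEntries S) ∧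
      (P.closedLoop (t • K.restrictEntries S)).numUnstable ≤ P.numUnstable :=
    eventually_all.2 fun S => (P.eventually_wellPosed_smul _).and
      (P.eventually_numUnstable_closedLoop_smul_le _)
  obtain ⟨t, hmove, hsmall⟩ := ((LTISystem.eventually_notMem_modes_closedLoop_smul hKwp hKα).and
    (hsmall.filter_mono nhdsWithin_le_nhds)).exists
  -- switching on the entries one at a time, `α` is lost at some entry `(i, j)`
  obtain ⟨S, ⟨i, j⟩, hij, hS, hins⟩ := Finset.exists_and_not_insert
    (Q := fun S => α ∈ (P.closedLoop (t • K.restrictEntries S)).modes)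
    (by
      have h0 : K.restrictEntries ∅ = 0 := by ext; simp [Matrix.restrictEntries]
      rw [h0, smul_zero, LTISystem.closedLoop_zero]
      exact hα.1)
    (by
      have h1 : K.restrictEntries Finset.univ = K := by ext; simp [Matrix.restrictEntries]
      rwa [h1])
  have hdiff : t • K.restrictEntries (insert (i, j) S) - t • K.restrictEntries S =
      Matrix.single i j (t * K i j) := by
    rw [← smul_sub, K.restrictEntries_insert_sub hij, Matrix.smul_single, smul_eq_mul]
  have hAdm : (i, j) ∈ Adm := by
    by_contra h
    rw [hK i j h, mul_zero, Matrix.single_zero, sub_eq_zero] at hdiff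
    rw [hdiff] at hins
    exact hins hS
  have hunc : α ∉ ((P.closedLoop (t • K.restrictEntries S)).siso i j).uncontrollableModes :=
    fun h => hins (LTISystem.mem_modes_of_mem_uncontrollableModes (hsmall _).1 (hsmall _).1
      hdiff h)
  have huno : α ∉ ((P.closedLoop (t • K.restrictEntries S)).siso i j).unobservableModes :=
    fun h => hins (LTISystem.mem_modes_of_mem_unobservableModes (hsmall _).1 (hsmall _).1
      hdiff h)
  have hnum : ((P.closedLoop (t • K.restrictEntries S)).siso i j).numUnstable ≤ P.numUnstable :=
    (hsmall S).2
  refine ⟨t • K.restrictEntries S, fun a b hab => ?_, (hsmall S).1, i, j, hAdm,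
    ⟨α, hα, LTISystem.mem_controllableObservableModes hS hunc huno, hunc, huno⟩, ?_, hnum⟩
  · simp [Matrix.restrictEntries, hK a b hab]
  · rw [LTISystem.numUnstableNonFixed_eq_numUnstable hfixed]
    exact (LTISystem.numUnstableNonFixed_le_numUnstable _ _).trans hnum
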